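/- Throughout, theories are complete first-order theories, structures are nonempty, and $n\ge 2$ is an integer. An $n$-formula of $T$ is a formula that is $T$-equivalent to a Boolean combination of formulas in $n$ free variables. The theory $T$ is *almost $n$-ary* if there are finitely many formulas $\varphi_1(\overline x),\dots,\varphi_m(\overline x)$ such that every formula is $T$-equivalent to a Boolean combination of $n$-formulas and of formulas obtained from $\varphi_1,\dots,\varphi_m$ by substitutions of free variables. It is *almost $n$-aritizable* if some expansion of $T$ to a larger language is almost $n$-ary. Let $\mathcal M,\mathcal N$ be structures of relational languages $\Sigma_{\mathcal M},\Sigma_{\mathcal N}$, which may share symbols. The composition $\mathcal M[\mathcal N]$ is the structure of language $\Sigma_{\mathcal M}\cup\Sigma_{\mathcal N}$ with universe $M\times N$ in which a $k$-ary symbol $R$ holds of $((a_1,b_1),\dots,(a_k,b_k))$ iff * (outer part) $R\in\Sigma_{\mathcal M}$ and $\mathcal M\models R(a_1,\dots,a_k)$, or * (inner part) $R\in\Sigma_{\mathcal N}$, $a_1=\dots=a_k$ and $\mathcal N\models R(b_1,\dots,b_k)$. A composition $T_1[T_2]$ of theories is $\mathrm{Th}(\mathcal M[\mathcal N])$ for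 some $\mathcal M\models T_1$, $\mathcal N\models T_2$. The composition is *$E$-definable* if the equivalence relation $E=\{((a,b),(a',b')) : a=a'\}$ is $\emptyset$-definable in $\mathcal M[\mathcal N]$. It *separates the common symbols* if for every $R\in\Sigma_{\mathcal M}\cap\Sigma_{\mathcal N}$ both the outer part and the inner part of $R$ are $\emptyset$-definable in $\mathcal M[\mathcal N]$ (this is vacuous when the languages are disjoint). A composition of finitely many theories $T_1,\dots,T_m$ ($m\ge1$) is any theory obtained from them, in this order and with any bracketing, by iterating the binary composition. **Corollary.** Let $n\ge 2$. 1. If $T_1,\dots,T_m$ are almost $n$-ary, then every composition of $T_1,\dots,T_m$ in which each binary step is $E$-definable and separates the common symbols is almost $n$-ary. 2. If $T_1,\dots,T_m$ are almost $n$-aritizable, then every composition of $T_1,\dots,T_m$ is almost $n$-aritizable. -/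

import Mathlib

open FirstOrder FirstOrder.Language

universe u v

namespace AlmostArity

/-! ### Almost `n`-ary and almost `n`-aritizable theories -/

section Arity

/-- The Boolean combinations of the formulas in `Δ`. Variables are indexed by `ℕ`. -/
inductive BoolComb {L : FirstOrder.Language.{u, v}} (Δ : Set (L.Formula ℕ)) : L.Formula ℕ → Prop
  | of (φ : L.Formula ℕ) (h : φ ∈ Δ) : BoolComb Δ φ
  | not (φ : L.Formula ℕ) (h : BoolComb Δ φ) : BoolComb Δ φ.not
  | and (φ ψ : L.Formula ℕ) (h : BoolComb Δ φ) (h' : BoolComb Δ ψ) : BoolComb Δ (φ ⊓ ψ)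
  | or (φ ψ : L.Formula ℕ) (h : BoolComb Δ φ) (h' : BoolComb Δ ψ) : BoolComb Δ (φ ⊔ ψ)

/-- The formulas obtained from `φ(x₁, …, x_k)` by substituting variables for `x₁, …, x_k`. -/
def substInstances {L : FirstOrder.Language.{u, v}} {k : ℕ} (φ : L.Formula (Fin k)) :
    Set (L.Formula ℕ) :=
  {ψ | ∃ f : Fin k → ℕ, ψ = φ.relabel f}

/-- `φ` is an `n`-formula of `T`: it is `T`-equivalent to a Boolean combination of formulas
in `n` free variables. -/
def IsNFormula {L : FirstOrder.Language.{u, v}} (T : L.Theory) (n : ℕ) (φ : L.Formula ℕ) : Prop :=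
  ∃ ψ : L.Formula ℕ, BoolComb (⋃ χ : L.Formula (Fin n), substInstances χ) ψ ∧ (φ ⇔[T] ψ)

/-- `T` is almost `n`-ary: for some finite list of formulas `φ₁(x̄), …, φ_m(x̄)`, every formula is
`T`-equivalent to a Boolean combination of `n`-formulas and of formulas obtained from the `φᵢ` by
substitutions of free variables. -/
def AlmostNAry {L : FirstOrder.Language.{u, v}} (n : ℕ) (T : L.Theory) : Prop :=
  ∃ (m k : ℕ) (φ : Fin m → L.Formula (Fin k)), ∀ χ : L.Formula ℕ, ∃ ψ : L.Formula ℕ,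
    BoolComb ({θ | IsNFormula T n θ} ∪ ⋃ i, substInstances (φ i)) ψ ∧ (χ ⇔[T] ψ)

/-- `T` is almost `n`-aritizable: some (complete) expansion of `T`, in a language with arbitrary
additional symbols, is almost `n`-ary. -/
def AlmostNAritizable {L : FirstOrder.Language.{u, v}} (n : ℕ) (T : L.Theory) : Prop :=
  ∃ (L' : FirstOrder.Language.{max u v, max u v}) (T' : (L.sum L').Theory),
    T'.IsComplete ∧ (LHom.sumInl : L →ᴸ L.sum L').onTheory T ⊆ T' ∧ AlmostNAry n T'

end Arity

/-! ### Compositions of structures -/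

section Composition

/-- A relational signature: a set of relation symbols, where `S k` is the ambient type of
`k`-ary relation symbols. Different signatures may share symbols. -/
abbrev Signature (S : ℕ → Type u) : Type u := ∀ k, Set (S k)

/-- The relational language with the symbols in `σ`. -/
def Signature.lang {S : ℕ → Type u} (σ : Signature S) : FirstOrder.Language.{u, u} where
  Functions _ := PEmpty.{u + 1}
  Relations k := {R : S k // R ∈ σ k}

/-- The union of two signatures. -/
abbrev Signature.union {S : ℕ → Type u} (σ τ : Signature S) : Signature S :=
  fun k => σ k ∪ τ k

variable {S : ℕ → Type u} (σ τ : Signature S) (M N : Type u)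
  [σ.lang.Structure M] [τ.lang.Structure N]

/-- The relation on `M × N` that a symbol of the signature of `M` contributes: it holds of
`((a₁, b₁), …, (a_k, b_k))` iff `R` holds of `(a₁, …, a_k)` in `M`. -/
def outerRel {k : ℕ} (R : σ.lang.Relations k) : Set (Fin k → M × N) :=
  {x | Structure.RelMap R fun i => (x i).1}

/-- The relation on `M × N` that a symbol of the signature of `N` contributes: it holds of
`((a₁, b₁), …, (a_k, b_k))` iff `a₁ = … = a_k` and `R` holds of `(b₁, …, b_k)` in `N`. -/
def innerRel {k : ℕ} (R : τ.lang.Relations k) : Set (Fin k → M × N) :=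
  {x | (∀ i j, (x i).1 = (x j).1) ∧ Structure.RelMap R fun i => (x i).2}

/-- The composition `M[N]`, with universe `M × N` and the union of both signatures. -/
@[reducible]
def compStructure : (σ.union τ).lang.Structure (M × N) where
  funMap f := PEmpty.elim f
  RelMap {k} R x :=
    (∃ h : R.1 ∈ σ k, x ∈ outerRel σ M N ⟨R.1, h⟩) ∨
      (∃ h : R.1 ∈ τ k, x ∈ innerRel τ M N ⟨R.1, h⟩)

/-- A symbol of `M` that is not a symbol of `N`. -/
theorem relMap_comp_of_left {k : ℕ} (R : S k) (hσ : R ∈ σ k) (hτ : R ∉ τ k)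
    (x : Fin k → M × N) :
    (compStructure σ τ M N).RelMap ⟨R, Or.inl hσ⟩ x ↔
      Structure.RelMap (L := σ.lang) ⟨R, hσ⟩ fun i => (x i).1 := by
  constructor
  · rintro (⟨_, h⟩ | ⟨h, _⟩)
    · exact h
    · exact absurd h hτ
  · exact fun h => Or.inl ⟨hσ, h⟩

/-- A symbol of `N` that is not a symbol of `M`. -/
theorem relMap_comp_of_right {k : ℕ} (R : S k) (hσ : R ∉ σ k) (hτ : R ∈ τ k)
    (x : Fin k → M × N) :
    (compStructure σ τ M N).RelMap ⟨R, Or.inr hτ⟩ x ↔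
      (∀ i j, (x i).1 = (x j).1) ∧
        Structure.RelMap (L := τ.lang) ⟨R, hτ⟩ fun i => (x i).2 := by
  constructor
  · rintro (⟨h, _⟩ | ⟨_, h⟩)
    · exact absurd h hσ
    · exact h
  · exact fun h => Or.inr ⟨hτ, h⟩

/-- A common symbol of `M` and `N`. -/
theorem relMap_comp_of_both {k : ℕ} (R : S k) (hσ : R ∈ σ k) (hτ : R ∈ τ k)
    (x : Fin k → M × N) :
    (compStructure σ τ M N).RelMap ⟨R, Or.inl hσ⟩ x ↔
      (Structure.RelMap (L := σ.lang) ⟨R, hσ⟩ fun i => (x i).1) ∨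
      ((∀ i j, (x i).1 = (x j).1) ∧
        Structure.RelMap (L := τ.lang) ⟨R, hτ⟩ fun i => (x i).2) := by
  constructor
  · rintro (⟨_, h⟩ | ⟨_, h⟩)
    · exact Or.inl h
    · exact Or.inr h
  · rintro (h | h)
    · exact Or.inl ⟨hσ, h⟩
    · exact Or.inr ⟨hτ, h⟩

/-- A subset of `(M × N)^α` is `∅`-definable in `M[N]`. -/
def DefinableInComp {α : Type} (s : Set (α → M × N)) : Prop :=
  letI := compStructure σ τ M N
  (∅ : Set (M × N)).Definable (σ.union τ).lang s

/-- `M[N]` is `E`-definable: the equivalence relation whose classes are the universes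
`{a} × N` of the copies of `N` is `∅`-definable in `M[N]`. -/
def IsEDefinable : Prop :=
  DefinableInComp σ τ M N {x : Fin 2 → M × N | (x 0).1 = (x 1).1}

/-- For every common symbol `R` of `M` and `N`, whose interpretation in `M[N]` is the union of
the two relations contributed by `M` and by `N`, both of these relations are `∅`-definable in
`M[N]`. This holds vacuously if the signatures are disjoint. -/
def SeparatesCommonSymbols : Prop :=
  ∀ (k : ℕ) (R : S k) (hσ : R ∈ σ k) (hτ : R ∈ τ k),
    DefinableInComp σ τ M N (outerRel σ M N ⟨R, hσ⟩) ∧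
      DefinableInComp σ τ M N (innerRel τ M N ⟨R, hτ⟩)

end Composition

/-! ### Compositions of theories -/

section Theories

/-- A complete theory in a relational signature. -/
structure RelTheory (S : ℕ → Type u) where
  sig : Signature S
  theory : sig.lang.Theory
  complete : theory.IsComplete

/-- The complete theory `Th(M)` of a nonempty structure. -/
def RelTheory.ofStructure {S : ℕ → Type u} (σ : Signature S) (M : Type u)
    [σ.lang.Structure M] [Nonempty M] : RelTheory S where
  sig := σ
  theory := σ.lang.completeTheory M
  complete := (completeTheory.isMaximal σ.lang M).isComplete

/-- The theory `Th(M[N])`. -/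
def RelTheory.ofComp {S : ℕ → Type u} (σ τ : Signature S) (M N : Type u)
    [σ.lang.Structure M] [τ.lang.Structure N] [Nonempty M] [Nonempty N] : RelTheory S :=
  letI := compStructure σ τ M N
  RelTheory.ofStructure (σ.union τ) (M × N)

/-- `T` is the composition `T₁[T₂]`, i.e. `T = Th(M[N])` where `M ⊨ T₁` and `N ⊨ T₂`. -/
def IsComp {S : ℕ → Type u} (T₁ T₂ T : RelTheory S) : Prop :=
  ∃ (M N : Type u) (_ : T₁.sig.lang.Structure M) (_ : T₂.sig.lang.Structure N)
    (_ : Nonempty M) (_ : Nonempty N),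
    M ⊨ T₁.theory ∧ N ⊨ T₂.theory ∧ T = RelTheory.ofComp T₁.sig T₂.sig M N

/-- `T` is the composition `T₁[T₂]`, and this composition is `E`-definable and separates the
common symbols. -/
def IsEDefComp {S : ℕ → Type u} (T₁ T₂ T : RelTheory S) : Prop :=
  ∃ (M N : Type u) (_ : T₁.sig.lang.Structure M) (_ : T₂.sig.lang.Structure N)
    (_ : Nonempty M) (_ : Nonempty N),
    M ⊨ T₁.theory ∧ N ⊨ T₂.theory ∧ T = RelTheory.ofComp T₁.sig T₂.sig M N ∧
      IsEDefinable T₁.sig T₂.sig M N ∧ SeparatesCommonSymbols T₁.sig T₂.sig M N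

/-- `FiniteComp comp l T`: the theory `T` is obtained from the theories in the nonempty finite
list `l`, in this order and with an arbitrary bracketing, by iterating the binary composition
`comp`. -/
inductive FiniteComp {S : ℕ → Type u} (comp : RelTheory S → RelTheory S → RelTheory S → Prop) :
    List (RelTheory S) → RelTheory S → Prop
  | single (T : RelTheory S) : FiniteComp comp [T] T
  | comp (l₁ l₂ : List (RelTheory S)) (T₁ T₂ T : RelTheory S)
      (h₁ : FiniteComp comp l₁ T₁) (h₂ : FiniteComp comp l₂ T₂) (h : comp T₁ T₂ T) :
      FiniteComp comp (l₁ ++ l₂) T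

end Theories

end AlmostArity

/-! Both parts are inductions on the bracketing, so they reduce to one composition `M[N]`. The
engine is a Feferman–Vaught argument: truth of a formula at a tuple of `M × N` depends only on the
truth values of finitely many outer formulas (evaluated at first coordinates) and inner formulas
(evaluated at second coordinates, on a set of variables lying in a single copy of `N`). This is
`Determined`; its only hard case is the existential quantifier, `Determined.ex`.

Finite dependence on truth values is a Boolean combination. If outer and inner predicates are
definable in the product, the Boolean combinations given by almost `n`-arity of `M` and `N` can be
substituted into it (`almostNAry_prod`). The special formulas of the product are the outer and inner
versions of those of the factors; the bound `2 ≤ n` makes "same copy" an `n`-formula.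

For part 1, `E`-definability and separation supply definitions of the outer and inner predicates.
For part 2, these predicates are added to the language (`traceLang`). There the factors are replaced
by models of their almost `n`-ary expansions, which leaves the theory of the composition unchanged
since composition preserves elementary equivalence. To give that as well, `Determined` compares
assignments in different members of a family. -/

namespace AlmostArity

/-! ### Uniformly definable predicates on families of structures -/

section UDef

universe w w'

variable {L : FirstOrder.Language.{u, v}} {I : Type w} {X : I → Type w'} [∀ i, L.Structure (X i)]

variable (L X) in
/-- A family of predicates on assignments that is defined by one formula in all structures `X i`. -/
def UDef (p : ∀ i, (ℕ → X i) → Prop) : Prop :=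
  ∃ φ : L.Formula ℕ, ∀ i v, φ.Realize v ↔ p i v

/-- The family of predicates `p` only depends on the variables in `D`. -/
def Supp (p : ∀ i, (ℕ → X i) → Prop) (D : Finset ℕ) : Prop :=
  ∀ i v v', (∀ k ∈ D, v k = v' k) → p i v → p i v'

theorem UDef.not {p : ∀ i, (ℕ → X i) → Prop} (h : UDef L X p) : UDef L X fun i v => ¬ p i v := by
  obtain ⟨φ, hφ⟩ := h
  exact ⟨φ.not, fun i v => by rw [Formula.realize_not, hφ]⟩

theorem UDef.and {p q : ∀ i, (ℕ → X i) → Prop} (h : UDef L X p) (h' : UDef L X q) :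
    UDef L X fun i v => p i v ∧ q i v := by
  obtain ⟨φ, hφ⟩ := h
  obtain ⟨ψ, hψ⟩ := h'
  exact ⟨φ ⊓ ψ, fun i v => by rw [Formula.realize_inf, hφ, hψ]⟩

theorem UDef.comp {p : ∀ i, (ℕ → X i) → Prop} (h : UDef L X p) (f : ℕ → ℕ) :
    UDef L X fun i v => p i (v ∘ f) := by
  obtain ⟨φ, hφ⟩ := h
  exact ⟨φ.relabel f, fun i v => by rw [Formula.realize_relabel, hφ]⟩

theorem UDef.ex {p : ∀ i, (ℕ → X i) → Prop} (j : ℕ) (h : UDef L X p) :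
    UDef L X fun i v => ∃ a, p i (Function.update v j a) := by
  obtain ⟨φ, hφ⟩ := h
  refine ⟨Formula.iExs Unit (φ.relabel fun k => if k = j then Sum.inr () else Sum.inl k),
    fun i v => ?_⟩
  rw [Formula.realize_iExs]
  have key (a : Unit → X i) : (Sum.elim v a ∘ fun k => if k = j then Sum.inr () else Sum.inl k) =
      Function.update v j (a ()) := by
    ext k
    by_cases hk : k = j
    · subst hk; simp
    · simp [hk]
  simp only [Formula.realize_relabel, key, hφ]
  exact ⟨fun ⟨a, ha⟩ => ⟨a (), ha⟩, fun ⟨a, ha⟩ => ⟨fun _ => a, ha⟩⟩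

theorem UDef.eq (j k : ℕ) : UDef L X fun _ v => v j = v k :=
  ⟨Term.equal (Term.var j) (Term.var k), fun i v => by simp [Formula.realize_equal]⟩

theorem UDef.rel {k : ℕ} (R : L.Relations k) (f : Fin k → ℕ) :
    UDef L X fun _ v => Structure.RelMap R (v ∘ f) :=
  ⟨R.formula fun i => Term.var (f i), fun i v => by rw [Formula.realize_rel]; rfl⟩

theorem UDef.const (P : Prop) : UDef L X fun _ _ => P := by
  by_cases hP : P
  · exact ⟨⊤, fun i v => by simp [hP]⟩
  · exact ⟨⊥, fun i v => by simp [hP]⟩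

theorem UDef.or {p q : ∀ i, (ℕ → X i) → Prop} (h : UDef L X p) (h' : UDef L X q) :
    UDef L X fun i v => p i v ∨ q i v := by
  simpa only [not_and_or, not_not] using (h.not.and h'.not).not

theorem UDef.iff_const {p : ∀ i, (ℕ → X i) → Prop} (h : UDef L X p) (P : Prop) :
    UDef L X fun i v => (p i v ↔ P) := by
  by_cases hP : P
  · simpa only [hP, iff_true] using h
  · simpa only [hP, iff_false] using h.not

theorem UDef.forall_mem_finite {β : Type*} {s : Set β} (hs : s.Finite)
    {q : β → ∀ i, (ℕ → X i) → Prop} (h : ∀ b ∈ s, UDef L X (q b)) :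
    UDef L X fun i v => ∀ b ∈ s, q b i v := by
  induction s, hs using Set.Finite.induction_on with
  | empty => simpa using UDef.const True
  | @insert b t _ _ ih =>
    simpa only [Set.forall_mem_insert] using
      (h b (Set.mem_insert _ _)).and (ih fun c hc => h c (Set.mem_insert_of_mem _ hc))

/-- Every property of families of predicates which is closed under the logical operations and
which holds for atomic predicates in a relational language holds for all formulas. -/
theorem boundedFormula_induction [L.IsRelational] {P : (∀ i, (ℕ → X i) → Prop) → Prop}
    (not : ∀ p, P p → P fun i v => ¬ p i v)
    (and : ∀ p q, P p → P q → P fun i v => p i v ∧ q i v)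
    (ex : ∀ p j, P p → P fun i v => ∃ a, p i (Function.update v j a))
    (eq : ∀ j k, P fun _ v => v j = v k)
    (rel : ∀ (k : ℕ) (R : L.Relations k) (f : Fin k → ℕ), P fun _ v => Structure.RelMap R (v ∘ f))
    {α : Type} [Finite α] {n : ℕ} (φ : L.BoundedFormula α n) :
    ∀ (g : α → ℕ) (h : Fin n → ℕ), P fun _ v => φ.Realize (v ∘ g) (v ∘ h) := by
  have term {n : ℕ} (g : α → ℕ) (h : Fin n → ℕ) (t : L.Term (α ⊕ Fin n)) : ∃ j : ℕ,
      ∀ (i : I) (v : ℕ → X i), t.realize (Sum.elim (v ∘ g) (v ∘ h)) = v j := by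
    cases t with
    | var a => exact ⟨Sum.elim g h a, fun i v => by cases a <;> rfl⟩
    | func f ts => exact isEmptyElim f
  induction φ with
  | falsum =>
    intro g h
    simpa [BoundedFormula.Realize] using not _ (eq 0 0)
  | equal t₁ t₂ =>
    intro g h
    obtain ⟨j, hj⟩ := term g h t₁
    obtain ⟨k, hk⟩ := term g h t₂
    simpa only [BoundedFormula.Realize, hj, hk] using eq j k
  | @rel n l R ts =>
    intro g h
    choose f hf using fun i => term g h (ts i)
    have := rel _ R f
    simp only [BoundedFormula.Realize, hf]
    exact this
  | imp φ₁ φ₂ ih₁ ih₂ =>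
    intro g h
    simpa only [BoundedFormula.realize_imp, not_and, not_not] using
      not _ (and _ _ (ih₁ g h) (not _ (ih₂ g h)))
  | @all n φ ih =>
    intro g h
    -- The bound de Bruijn variable is named by a fresh `j`, so that updating `j` leaves the other
    -- variables untouched.
    obtain ⟨j, hj⟩ := ((Set.finite_range g).union (Set.finite_range h)).exists_notMem
    have hg (a : α) : g a ≠ j := fun e => hj (Or.inl ⟨a, e⟩)
    have hh (a : Fin n) : h a ≠ j := fun e => hj (Or.inr ⟨a, e⟩)
    have := not _ (ex _ j (not _ (ih g (Fin.snoc h j))))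
    simp only [not_exists, not_not] at this
    have hgj (i : I) (v : ℕ → X i) (a : X i) : Function.update v j a ∘ g = v ∘ g := by
      ext a'
      simp [hg]
    have hhj (i : I) (v : ℕ → X i) (a : X i) :
        Function.update v j a ∘ (Fin.snoc h j : Fin (n + 1) → ℕ) = Fin.snoc (v ∘ h) a := by
      ext a'
      refine Fin.lastCases ?_ (fun b => ?_) a' <;> simp [hh]
    simpa only [hgj, hhj, BoundedFormula.realize_all] using this

theorem formula_induction [L.IsRelational] {P : (∀ i, (ℕ → X i) → Prop) → Prop}
    (not : ∀ p, P p → P fun i v => ¬ p i v)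
    (and : ∀ p q, P p → P q → P fun i v => p i v ∧ q i v)
    (ex : ∀ p j, P p → P fun i v => ∃ a, p i (Function.update v j a))
    (eq : ∀ j k, P fun _ v => v j = v k)
    (rel : ∀ (k : ℕ) (R : L.Relations k) (f : Fin k → ℕ), P fun _ v => Structure.RelMap R (v ∘ f))
    {α : Type} [Finite α] (φ : L.Formula α) (g : α → ℕ) : P fun _ v => φ.Realize (v ∘ g) := by
  have := boundedFormula_induction not and ex eq rel φ g default
  simpa only [Formula.Realize, Subsingleton.elim _ (default : Fin 0 → _)] using this

/-- One quantifier step of an Ehrenfeucht–Fraïssé argument. For each `s ⊆ 𝒜`, the set `𝒜'` contains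
the predicate "some value at `j` makes exactly the members of `s` true"; agreement on these lets any
choice of `a` be answered. -/
theorem finite_back_and_forth (j : ℕ) {𝒜 : Set (∀ i, (ℕ → X i) → Prop)} (hfin : 𝒜.Finite)
    (hdef : ∀ p ∈ 𝒜, UDef L X p) :
    ∃ 𝒜' : Set (∀ i, (ℕ → X i) → Prop), 𝒜'.Finite ∧ (∀ p ∈ 𝒜', UDef L X p) ∧
      (∀ D : Finset ℕ, (∀ p ∈ 𝒜, Supp p (insert j D)) → ∀ p ∈ 𝒜', Supp p D) ∧
      ∀ i i' (v : ℕ → X i) (v' : ℕ → X i'), (∀ p ∈ 𝒜', p i v ↔ p i' v') →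
        ∀ a, ∃ a', ∀ p ∈ 𝒜, p i (Function.update v j a) ↔ p i' (Function.update v' j a') := by
  refine ⟨(fun (s : Set (∀ i, (ℕ → X i) → Prop)) (i : I) (v : ℕ → X i) =>
    ∃ a, ∀ p ∈ 𝒜, (p i (Function.update v j a) ↔ p ∈ s)) '' 𝒜.powerset,
    hfin.finite_subsets.image _, ?_, ?_, ?_⟩
  · rintro _ ⟨s, -, rfl⟩
    exact (UDef.forall_mem_finite hfin
      (q := fun p i v => p i v ↔ p ∈ s) fun p hp => (hdef p hp).iff_const _).ex j
  · rintro D hD _ ⟨s, -, rfl⟩ i v v' hv ⟨a, ha⟩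
    refine ⟨a, fun p hp => Iff.trans ?_ (ha p hp)⟩
    have (k : ℕ) (hk : k ∈ insert j D) :
        Function.update v j a k = Function.update v' j a k := by
      by_cases hkj : k = j
      · subst hkj; simp
      · simpa [hkj] using hv k (Finset.mem_of_mem_insert_of_ne hk hkj)
    exact ⟨hD p hp i _ _ fun k hk => (this k hk).symm, hD p hp i _ _ this⟩
  · intro i i' v v' h a
    obtain ⟨a', ha'⟩ := (h _ ⟨{p ∈ 𝒜 | p i (Function.update v j a)}, fun p hp => hp.1, rfl⟩).1
      ⟨a, fun p hp => by simp [hp]⟩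
    exact ⟨a', fun p hp => ((ha' p hp).trans (by simp [hp])).symm⟩

/-! ### Transfer of satisfiability and equivalence between models -/

theorem exists_realize_iff_exClosure (φ : L.Formula ℕ) (M : Type*) [L.Structure M] [Nonempty M] :
    (∃ v : ℕ → M, φ.Realize v) ↔ M ⊨ φ.exClosure := by
  rw [Formula.realize_exClosure]
  constructor
  · rintro ⟨v, hv⟩
    exact ⟨fun a => v a, (φ.realize_restrictFreeVar (f := id) (v := fun a => v a) v fun _ => rfl).2 hv⟩
  · rintro ⟨v, hv⟩
    classical
    refine ⟨fun a => if h : a ∈ φ.freeVarFinset then v ⟨a, h⟩ else Classical.arbitrary M,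
      (BoundedFormula.realize_restrictFreeVar _ fun a => ?_).1 hv⟩
    simp

theorem UDef.exists_iff {p : ∀ i, (ℕ → X i) → Prop} (h : UDef L X p) {i i' : I}
    [Nonempty (X i)] [Nonempty (X i')] (hi : X i ≅[L] X i') :
    (∃ v, p i v) ↔ ∃ v, p i' v := by
  obtain ⟨φ, hφ⟩ := h
  simp only [← hφ, exists_realize_iff_exClosure]
  exact ElementarilyEquivalent.realize_sentence hi φ.exClosure

theorem forall_realize_iff_of_isComplete {T : L.Theory} (hT : T.IsComplete) (M : Type*)
    [L.Structure M] [Nonempty M] [M ⊨ T] (φ ψ : L.Formula ℕ) :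
    (∀ v : ℕ → M, φ.Realize v ↔ ψ.Realize v) ↔ ¬ T ⊨ᵇ (φ.iff ψ).not.exClosure := by
  rw [← hT.realize_sentence_iff _ M, ← exists_realize_iff_exClosure, not_exists]
  exact forall_congr' fun v => by rw [Formula.realize_not, Formula.realize_iff, not_not]

/-- In a complete theory, equivalence of formulas can be checked in one model. -/
theorem iff_of_isComplete {T : L.Theory} (hT : T.IsComplete) (M : Type*) [L.Structure M]
    [Nonempty M] [M ⊨ T] {φ ψ : L.Formula ℕ} :
    (φ ⇔[T] ψ) ↔ ∀ v : ℕ → M, φ.Realize v ↔ ψ.Realize v := by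
  constructor
  · intro h v
    exact h.realize_iff
  · intro h N v xs
    rw [forall_realize_iff_of_isComplete hT M, ← forall_realize_iff_of_isComplete hT N] at h
    rw [BoundedFormula.realize_iff, Subsingleton.elim xs default]
    exact h v

end UDef

/-! ### Predicates on products that are determined by outer and inner formulas -/

section Determined

universe u₁ v₁ u₂ v₂ w w₁ w₂

variable {L₁ : FirstOrder.Language.{u₁, v₁}} {L₂ : FirstOrder.Language.{u₂, v₂}} {I : Type w}
  {M : I → Type w₁} {N : I → Type w₂} [∀ i, L₁.Structure (M i)] [∀ i, L₂.Structure (N i)]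

/-- The first coordinates of `v j`, for `j ∈ C`, agree, and the second coordinates satisfy `q`. -/
def Inner (C : Finset ℕ) (q : ∀ i, (ℕ → N i) → Prop) (i : I) (v : ℕ → M i × N i) : Prop :=
  (∀ j ∈ C, ∀ k ∈ C, (v j).1 = (v k).1) ∧ q i fun k => (v k).2

/-- The assignments `v` and `v'` agree on the outer predicates in `𝒜` and on the inner predicates
in `ℬ`. -/
def Agree (𝒜 : Set (∀ i, (ℕ → M i) → Prop)) (ℬ : Set (Finset ℕ × ∀ i, (ℕ → N i) → Prop))
    {i i' : I} (v : ℕ → M i × N i) (v' : ℕ → M i' × N i') : Prop :=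
  (∀ p ∈ 𝒜, p i (fun k => (v k).1) ↔ p i' fun k => (v' k).1) ∧
    ∀ b ∈ ℬ, Inner b.1 b.2 i v ↔ Inner b.1 b.2 i' v'

theorem Agree.symm {𝒜 : Set (∀ i, (ℕ → M i) → Prop)} {ℬ : Set (Finset ℕ × ∀ i, (ℕ → N i) → Prop)}
    {i i' : I} {v : ℕ → M i × N i} {v' : ℕ → M i' × N i'} (h : Agree 𝒜 ℬ v v') :
    Agree 𝒜 ℬ v' v :=
  ⟨fun p hp => (h.1 p hp).symm, fun b hb => (h.2 b hb).symm⟩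

theorem Agree.mono {𝒜 𝒜' : Set (∀ i, (ℕ → M i) → Prop)}
    {ℬ ℬ' : Set (Finset ℕ × ∀ i, (ℕ → N i) → Prop)}
    {i i' : I} {v : ℕ → M i × N i} {v' : ℕ → M i' × N i'} (h : Agree 𝒜' ℬ' v v')
    (h₁ : 𝒜 ⊆ 𝒜') (h₂ : ℬ ⊆ ℬ') : Agree 𝒜 ℬ v v' :=
  ⟨fun p hp => h.1 p (h₁ hp), fun b hb => h.2 b (h₂ hb)⟩

variable (L₁ L₂ M N) in
/-- Whether an assignment in some `M i × N i` satisfies `s` only depends on the truth values of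
finitely many outer and inner formulas. -/
def Determined (s : ∀ i, (ℕ → M i × N i) → Prop) : Prop :=
  ∃ (𝒜 : Set (∀ i, (ℕ → M i) → Prop)) (ℬ : Set (Finset ℕ × ∀ i, (ℕ → N i) → Prop)),
    𝒜.Finite ∧ ℬ.Finite ∧ (∀ p ∈ 𝒜, UDef L₁ M p) ∧ (∀ b ∈ ℬ, UDef L₂ N b.2 ∧ Supp b.2 b.1) ∧
      ∀ i i' (v : ℕ → M i × N i) (v' : ℕ → M i' × N i'), Agree 𝒜 ℬ v v' → s i v → s i' v'

theorem Determined.not {s : ∀ i, (ℕ → M i × N i) → Prop} (h : Determined L₁ L₂ M N s) :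
    Determined L₁ L₂ M N fun i v => ¬ s i v := by
  obtain ⟨𝒜, ℬ, h𝒜, hℬ, hd𝒜, hdℬ, hs⟩ := h
  exact ⟨𝒜, ℬ, h𝒜, hℬ, hd𝒜, hdℬ, fun i i' v v' hv => mt (hs _ _ _ _ hv.symm)⟩

theorem Determined.and {s t : ∀ i, (ℕ → M i × N i) → Prop} (h : Determined L₁ L₂ M N s)
    (h' : Determined L₁ L₂ M N t) : Determined L₁ L₂ M N fun i v => s i v ∧ t i v := by
  obtain ⟨𝒜, ℬ, h𝒜, hℬ, hd𝒜, hdℬ, hs⟩ := h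
  obtain ⟨𝒜', ℬ', h𝒜', hℬ', hd𝒜', hdℬ', ht⟩ := h'
  refine ⟨𝒜 ∪ 𝒜', ℬ ∪ ℬ', h𝒜.union h𝒜', hℬ.union hℬ', ?_, ?_, fun i i' v v' hv h => ?_⟩
  · rintro p (hp | hp)
    exacts [hd𝒜 p hp, hd𝒜' p hp]
  · rintro p (hp | hp)
    exacts [hdℬ p hp, hdℬ' p hp]
  · exact ⟨hs _ _ _ _ (hv.mono Set.subset_union_left Set.subset_union_left) h.1,
      ht _ _ _ _ (hv.mono Set.subset_union_right Set.subset_union_right) h.2⟩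

theorem Determined.or {s t : ∀ i, (ℕ → M i × N i) → Prop} (h : Determined L₁ L₂ M N s)
    (h' : Determined L₁ L₂ M N t) : Determined L₁ L₂ M N fun i v => s i v ∨ t i v := by
  simpa only [not_and_or, not_not] using (h.not.and h'.not).not

theorem Determined.outer {p : ∀ i, (ℕ → M i) → Prop} (hp : UDef L₁ M p) :
    Determined L₁ L₂ M N fun i v => p i fun k => (v k).1 :=
  ⟨{p}, ∅, Set.finite_singleton _, Set.finite_empty, by simpa using hp, by simp,
    fun _ _ _ _ hv h => (hv.1 p rfl).1 h⟩

theorem Determined.inner {C : Finset ℕ} {q : ∀ i, (ℕ → N i) → Prop} (hq : UDef L₂ N q)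
    (hC : Supp q C) : Determined L₁ L₂ M N (Inner C q) :=
  ⟨∅, {(C, q)}, Set.finite_empty, Set.finite_singleton _, by simp, by simpa using ⟨hq, hC⟩,
    fun _ _ _ _ hv h => (hv.2 (C, q) rfl).1 h⟩

theorem Determined.const (P : Prop) : Determined L₁ L₂ M N fun _ _ => P :=
  ⟨∅, ∅, Set.finite_empty, Set.finite_empty, by simp, by simp, fun _ _ _ _ _ h => h⟩

theorem Determined.eq (j k : ℕ) : Determined L₁ L₂ M N fun _ v => v j = v k := by
  have := Determined.inner (L₁ := L₁) (M := M) (C := {j, k}) (UDef.eq (L := L₂) (X := N) j k)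
    fun i v v' h => by
      rw [h j (by simp), h k (by simp)]
      exact id
  convert this using 3 with i v
  simp only [Inner, Prod.ext_iff]
  refine and_congr_left fun _ => ⟨fun h => ?_, fun h => h j (by simp) k (by simp)⟩
  intro a ha b hb
  simp only [Finset.mem_insert, Finset.mem_singleton] at ha hb
  rcases ha with rfl | rfl <;> rcases hb with rfl | rfl <;> simp [h]

/-- A witness `(a, b)` is answered coordinatewise: first `a'` by back and forth in the outer family,
then `b'` by back and forth in the inner family, using only the variables that lie in the copy
chosen by `a`. Which variables these are is not known in advance, so inner predicates are provided
for every `D ⊆ V`. -/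
theorem Determined.ex {s : ∀ i, (ℕ → M i × N i) → Prop} (j : ℕ) (h : Determined L₁ L₂ M N s) :
    Determined L₁ L₂ M N fun i v => ∃ a, s i (Function.update v j a) := by
  classical
  obtain ⟨𝒜, ℬ, h𝒜, hℬ, hd𝒜, hdℬ, hs⟩ := h
  let V : Finset ℕ := insert j (hℬ.toFinset.biUnion Prod.fst)
  have hV {b} (hb : b ∈ ℬ) : b.1 ⊆ V := fun k hk =>
    Finset.mem_insert_of_mem (Finset.mem_biUnion.2 ⟨b, hℬ.mem_toFinset.2 hb, hk⟩)
  let pat : ℕ × ℕ → ∀ i, (ℕ → M i) → Prop := fun kl _ u => u kl.1 = u kl.2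
  -- Recording which first coordinates coincide makes the constancy clause of `Inner` transfer
  -- between assignments.
  let 𝒬 : Set (∀ i, (ℕ → M i) → Prop) := pat '' ↑(V ×ˢ V)
  obtain ⟨𝒜', h𝒜', hd𝒜', -, hbf⟩ := finite_back_and_forth (L := L₁) j
    (h𝒜.union ((V ×ˢ V).finite_toSet.image pat)) (by
      rintro p (hp | ⟨kl, -, rfl⟩)
      exacts [hd𝒜 p hp, UDef.eq _ _])
  have inner (D : Finset ℕ) := finite_back_and_forth (L := L₂) (X := N) j
    (𝒜 := Prod.snd '' {b ∈ ℬ | b.1 ⊆ insert j D}) ((hℬ.subset fun b hb => hb.1).image _) (by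
      rintro _ ⟨b, hb, rfl⟩
      exact (hdℬ b hb.1).1)
  choose ℬ' hℬ' hdℬ' hsℬ' hbf' using inner
  refine ⟨𝒜' ∪ 𝒬, ℬ ∪ ⋃ D ∈ V.powerset, (fun q => (D, q)) '' ℬ' D,
    h𝒜'.union ((V ×ˢ V).finite_toSet.image pat),
    hℬ.union (Set.Finite.biUnion V.powerset.finite_toSet fun D _ => (hℬ' D).image _), ?_, ?_, ?_⟩
  · rintro p (hp | ⟨kl, -, rfl⟩)
    exacts [hd𝒜' p hp, UDef.eq _ _]
  · rintro b (hb | hb)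
    · exact hdℬ b hb
    · simp only [Set.mem_iUnion] at hb
      obtain ⟨D, -, q, hq, rfl⟩ := hb
      refine ⟨hdℬ' D q hq, hsℬ' D D ?_ q hq⟩
      rintro _ ⟨b, hb, rfl⟩ i v v' h
      exact (hdℬ b hb.1).2 i v v' fun k hk => h k (hb.2 hk)
  · rintro i i' v v' hv ⟨⟨a, b⟩, hab⟩
    obtain ⟨a', ha'⟩ := hbf i i' _ _ (fun p hp => hv.1 p (Or.inl hp)) a
    have hpat {k l : ℕ} (hk : k ∈ V) (hl : l ∈ V) : (v k).1 = (v l).1 ↔ (v' k).1 = (v' l).1 :=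
      hv.1 _ (Or.inr ⟨(k, l), by simp [hk, hl], rfl⟩)
    -- The variables other than `j` in the copy of `N` above `a`. Constancy holds on `D` for both
    -- assignments, so `Inner D q` reduces to `q`.
    let D : Finset ℕ := {k ∈ V.erase j | (v k).1 = a}
    have hDV : D ⊆ V := fun k hk => Finset.mem_of_mem_erase (Finset.mem_filter.1 hk).1
    have hD {k l : ℕ} (hk : k ∈ D) (hl : l ∈ D) : (v k).1 = (v l).1 :=
      (Finset.mem_filter.1 hk).2.trans (Finset.mem_filter.1 hl).2.symm
    obtain ⟨b', hb'⟩ := hbf' D i i' (fun k => (v k).2) (fun k => (v' k).2) (fun q hq => by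
      have := hv.2 (D, q) (Or.inr (Set.mem_biUnion (Finset.mem_powerset.2 hDV) ⟨q, hq, rfl⟩))
      simp only [Inner] at this
      rwa [and_iff_right fun k hk l hl => hD hk hl,
        and_iff_right fun k hk l hl => (hpat (hDV hk) (hDV hl)).1 (hD hk hl)] at this) b
    have fst_update {i : I} (v : ℕ → M i × N i) (a : M i) (b : N i) :
        (fun k => (Function.update v j (a, b) k).1) = Function.update (fun k => (v k).1) j a := by
      ext k
      by_cases hk : k = j
      · subst hk; simp
      · simp [hk]
    have snd_update {i : I} (v : ℕ → M i × N i) (a : M i) (b : N i) :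
        (fun k => (Function.update v j (a, b) k).2) = Function.update (fun k => (v k).2) j b := by
      ext k
      by_cases hk : k = j
      · subst hk; simp
      · simp [hk]
    have hpat' {k l : ℕ} (hk : k ∈ V) (hl : l ∈ V) :
        (Function.update v j (a, b) k).1 = (Function.update v j (a, b) l).1 ↔
          (Function.update v' j (a', b') k).1 = (Function.update v' j (a', b') l).1 := by
      have := ha' _ (Or.inr ⟨(k, l), by simp [hk, hl], rfl⟩)
      rw [← fst_update v a b, ← fst_update v' a' b'] at this
      exact this
    refine ⟨(a', b'), hs _ _ _ _ ⟨fun p hp => ?_, fun c hc => ?_⟩ hab⟩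
    · rw [fst_update, fst_update]
      exact ha' p (Or.inl hp)
    · have hcV := hV hc
      have h₁ : (∀ k ∈ c.1, ∀ l ∈ c.1,
          (Function.update v j (a, b) k).1 = (Function.update v j (a, b) l).1) ↔
          ∀ k ∈ c.1, ∀ l ∈ c.1,
            (Function.update v' j (a', b') k).1 = (Function.update v' j (a', b') l).1 :=
        forall₂_congr fun k hk => forall₂_congr fun l hl => hpat' (hcV hk) (hcV hl)
      unfold Inner
      rw [← h₁]
      refine and_congr_right fun hconst => ?_
      rw [snd_update, snd_update]
      -- If `j ∈ c.1`, constancy forces `c.1 ⊆ insert j D`, so `b'` was chosen to handle `c`.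
      -- Otherwise the update is invisible to `c`, and the original agreement on `ℬ` applies.
      by_cases hj : j ∈ c.1
      · refine hb' c.2 ⟨c, ⟨hc, fun k hk => ?_⟩, rfl⟩
        by_cases hkj : k = j
        · simp [hkj]
        · have := hconst k hk j hj
          simp only [ne_eq, hkj, not_false_eq_true, Function.update_of_ne,
            Function.update_self] at this
          exact Finset.mem_insert_of_mem (Finset.mem_filter.2
            ⟨Finset.mem_erase.2 ⟨hkj, hcV hk⟩, this⟩)
      · have hne {k} (hk : k ∈ c.1) : k ≠ j := fun e => hj (e ▸ hk)
        have hsupp {i : I} (w : ℕ → N i) (y : N i) : c.2 i (Function.update w j y) ↔ c.2 i w :=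
          ⟨(hdℬ c hc).2 _ _ _ fun k hk => by simp [hne hk],
            (hdℬ c hc).2 _ _ _ fun k hk => by simp [hne hk]⟩
        rw [hsupp, hsupp]
        have hv₁ : ∀ k ∈ c.1, ∀ l ∈ c.1, (v k).1 = (v l).1 := fun k hk l hl => by
          simpa [hne hk, hne hl] using hconst k hk l hl
        have := hv.2 c (Or.inl hc)
        unfold Inner at this
        rwa [and_iff_right hv₁, and_iff_right fun k hk l hl =>
          (hpat (hcV hk) (hcV hl)).1 (hv₁ k hk l hl)] at this

theorem determined_realize {L : FirstOrder.Language.{u, v}} [L.IsRelational]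
    [∀ i, L.Structure (M i × N i)]
    (rel : ∀ (k : ℕ) (R : L.Relations k) (f : Fin k → ℕ),
      Determined L₁ L₂ M N fun _ v => Structure.RelMap R (v ∘ f))
    {α : Type} [Finite α] (φ : L.Formula α) (g : α → ℕ) :
    Determined L₁ L₂ M N fun _ v => φ.Realize (v ∘ g) :=
  formula_induction (L := L) (X := fun i => M i × N i)
    (P := Determined L₁ L₂ M N) (fun _ => Determined.not) (fun _ _ => Determined.and)
    (fun _ j => Determined.ex j) Determined.eq rel φ g

theorem determined_realize_nat {L : FirstOrder.Language.{u, v}} [L.IsRelational]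
    [∀ i, L.Structure (M i × N i)]
    (rel : ∀ (k : ℕ) (R : L.Relations k) (f : Fin k → ℕ),
      Determined L₁ L₂ M N fun _ v => Structure.RelMap R (v ∘ f)) (φ : L.Formula ℕ) :
    Determined L₁ L₂ M N fun _ v => φ.Realize v := by
  have := determined_realize rel (φ.restrictFreeVar id : L.Formula φ.freeVarFinset)
    Subtype.val
  convert this using 3 with i v
  exact (φ.realize_restrictFreeVar (f := id) (v := fun a => v a) v fun _ => rfl).symm

/-- The composition of structures preserves elementary equivalence. -/
theorem elementarilyEquivalent_prod {L : FirstOrder.Language.{u, v}} [L.IsRelational]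
    [∀ i, L.Structure (M i × N i)]
    (rel : ∀ (k : ℕ) (R : L.Relations k) (f : Fin k → ℕ),
      Determined L₁ L₂ M N fun _ v => Structure.RelMap R (v ∘ f))
    {i i' : I} [Nonempty (M i)] [Nonempty (N i)] [Nonempty (M i')] [Nonempty (N i')]
    (hM : M i ≅[L₁] M i') (hN : N i ≅[L₂] N i') : (M i × N i) ≅[L] (M i' × N i') := by
  classical
  rw [elementarilyEquivalent_iff]
  intro φ
  obtain ⟨𝒜, ℬ, h𝒜, hℬ, hd𝒜, hdℬ, hs⟩ := determined_realize rel φ Empty.elim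
  let V : Finset ℕ := hℬ.toFinset.biUnion Prod.fst
  have hV {b} (hb : b ∈ ℬ) : b.1 ⊆ V := fun k hk =>
    Finset.mem_biUnion.2 ⟨b, hℬ.mem_toFinset.2 hb, hk⟩
  let pat : ℕ × ℕ → ∀ i, (ℕ → M i) → Prop := fun kl _ u => u kl.1 = u kl.2
  -- An arbitrary assignment in `M i` has a finite pattern of truth values which is definable and
  -- satisfiable, hence also satisfied in `M i'`. The same is done for `N`; the resulting pairs
  -- agree, and a sentence ignores the assignment.
  obtain ⟨u, v, hv⟩ : ∃ (u : ℕ → M i) (u' : ℕ → M i'),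
      ∀ p ∈ 𝒜 ∪ pat '' ↑(V ×ˢ V), p i' u' ↔ p i u := by
    let u : ℕ → M i := fun _ => Classical.arbitrary _
    refine ⟨u, (UDef.exists_iff (UDef.forall_mem_finite (L := L₁) (X := M)
      (h𝒜.union ((V ×ˢ V).finite_toSet.image pat))
      (q := fun p i' u' => p i' u' ↔ p i u) ?_) hM).1 ⟨u, fun p hp => Iff.rfl⟩⟩
    rintro p (hp | ⟨kl, -, rfl⟩)
    exacts [(hd𝒜 p hp).iff_const _, (UDef.eq _ _).iff_const _]
  obtain ⟨w, z, hz⟩ : ∃ (w : ℕ → N i) (w' : ℕ → N i'), ∀ b ∈ ℬ, b.2 i' w' ↔ b.2 i w := by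
    let w : ℕ → N i := fun _ => Classical.arbitrary _
    exact ⟨w, (UDef.exists_iff (UDef.forall_mem_finite (L := L₂) (X := N) hℬ
      (q := fun b i' u' => b.2 i' u' ↔ b.2 i w) fun b hb => (hdℬ b hb).1.iff_const _) hN).1
        ⟨w, fun p hp => Iff.rfl⟩⟩
  have hag : Agree 𝒜 ℬ (fun k => (u k, w k)) fun k => (v k, z k) := by
    refine ⟨fun p hp => (hv p (Or.inl hp)).symm, fun b hb => and_congr ?_ (hz b hb).symm⟩
    exact forall₂_congr fun k hk => forall₂_congr fun l hl =>
      (hv _ (Or.inr ⟨(k, l), by simp [hV hb hk, hV hb hl], rfl⟩)).symm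
  have h₁ := hs _ _ _ _ hag
  have h₂ := hs _ _ _ _ hag.symm
  simp only [Subsingleton.elim _ (default : Empty → _)] at h₁ h₂
  exact ⟨h₁, h₂⟩

end Determined

/-! ### Almost `n`-arity of products -/

section Product

universe u₁ v₁ u₂ v₂ w w₁ w₂

/-- A predicate that only depends on the truth values of finitely many others is a Boolean
combination of these. -/
theorem of_finite_dependence {V β : Type*} {C : (V → Prop) → Prop}
    (const : ∀ P : Prop, C fun _ => P) (not : ∀ p, C p → C fun v => ¬ p v)
    (and : ∀ p q, C p → C q → C fun v => p v ∧ q v) {B : Set β} (hB : B.Finite)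
    (r : β → V → Prop) (hr : ∀ b ∈ B, C (r b)) :
    ∀ s : V → Prop, (∀ v v', (∀ b ∈ B, r b v ↔ r b v') → s v → s v') → C s := by
  induction B, hB using Set.Finite.induction_on with
  | empty =>
    intro s hs
    convert const (∃ v, s v) using 2 with v
    exact ⟨fun h => ⟨v, h⟩, fun ⟨v', h⟩ => hs v' v (by simp) h⟩
  | @insert b B _ _ ih =>
    intro s hs
    have hb := hr b (Set.mem_insert _ _)
    have ih := ih fun c hc => hr c (Set.mem_insert_of_mem _ hc)
    -- The saturation of `t` under agreement on `B` depends on `B` alone. On each side of `r b`, the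
    -- predicate `s` coincides with the saturation of its restriction to that side.
    have sat (t : V → Prop) : C fun v => ∃ v', (∀ c ∈ B, r c v ↔ r c v') ∧ t v' := by
      refine ih _ ?_
      rintro v v' h ⟨z, hz, ht⟩
      exact ⟨z, fun c hc => (h c hc).symm.trans (hz c hc), ht⟩
    have h₁ := and _ _ hb (sat fun v => r b v ∧ s v)
    have h₂ := and _ _ (not _ hb) (sat fun v => ¬ r b v ∧ s v)
    convert not _ (and _ _ (not _ h₁) (not _ h₂)) using 2 with v
    rw [← not_or, not_not]
    constructor
    · intro h
      by_cases hv : r b v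
      · exact Or.inl ⟨hv, v, fun _ _ => Iff.rfl, hv, h⟩
      · exact Or.inr ⟨hv, v, fun _ _ => Iff.rfl, hv, h⟩
    · rintro (⟨hv, v', h, hv', ht⟩ | ⟨hv, v', h, hv', ht⟩)
      · refine hs v' v ?_ ht
        rintro c (rfl | hc)
        exacts [iff_of_true hv' hv, (h c hc).symm]
      · refine hs v' v ?_ ht
        rintro c (rfl | hc)
        exacts [iff_of_false hv' hv, (h c hc).symm]

theorem Determined.bool_induction {L₁ : FirstOrder.Language.{u₁, v₁}}
    {L₂ : FirstOrder.Language.{u₂, v₂}} {M : Type w₁} {N : Type w₂} [L₁.Structure M]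
    [L₂.Structure N] {C : ((ℕ → M × N) → Prop) → Prop}
    (const : ∀ P : Prop, C fun _ => P) (not : ∀ p, C p → C fun v => ¬ p v)
    (and : ∀ p q, C p → C q → C fun v => p v ∧ q v)
    (outer : ∀ θ : L₁.Formula ℕ, C fun v => θ.Realize fun k => (v k).1)
    (inner : ∀ (D : Finset ℕ) (θ : L₂.Formula ℕ),
      (∀ w w' : ℕ → N, (∀ k ∈ D, w k = w' k) → θ.Realize w → θ.Realize w') →
      C fun v => (∀ j ∈ D, ∀ k ∈ D, (v j).1 = (v k).1) ∧ θ.Realize fun k => (v k).2)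
    {s : Unit → (ℕ → M × N) → Prop}
    (hs : Determined L₁ L₂ (fun _ : Unit => M) (fun _ : Unit => N) s) : C (s ()) := by
  obtain ⟨𝒜, ℬ, h𝒜, hℬ, hd𝒜, hdℬ, hs⟩ := hs
  refine of_finite_dependence const not and
    ((h𝒜.image Sum.inl).union (hℬ.image Sum.inr))
    (Sum.elim (fun p v => p () fun k => (v k).1)
      fun b => Inner (M := fun _ : Unit => M) b.1 b.2 ()) ?_ _ fun v v' h =>
    hs () () v v' ⟨fun p hp => h (Sum.inl p) (Or.inl ⟨p, hp, rfl⟩),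
      fun b hb => h (Sum.inr b) (Or.inr ⟨b, hb, rfl⟩)⟩
  rintro _ (⟨p, hp, rfl⟩ | ⟨b, hb, rfl⟩)
  · obtain ⟨θ, hθ⟩ := hd𝒜 p hp
    have := outer θ
    simp only [hθ ()] at this
    exact this
  · obtain ⟨⟨θ, hθ⟩, hsupp⟩ := hdℬ b hb
    have := inner b.1 θ fun w w' hw => by
      rw [hθ (), hθ ()]
      exact hsupp () w w' hw
    simp only [hθ ()] at this
    exact this

/-- The predicates defined by Boolean combinations of formulas in `n` free variables and of the
formulas obtained from the `φ i` by substitutions of free variables. -/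
inductive BoolDef {L : FirstOrder.Language.{u, v}} {M : Type w} [L.Structure M] (n : ℕ)
    {m k : ℕ} (φ : Fin m → L.Formula (Fin k)) : ((ℕ → M) → Prop) → Prop
  | small (χ : L.Formula (Fin n)) (f : Fin n → ℕ) : BoolDef n φ fun v => χ.Realize (v ∘ f)
  | subst (i : Fin m) (f : Fin k → ℕ) : BoolDef n φ fun v => (φ i).Realize (v ∘ f)
  | not (p : (ℕ → M) → Prop) (h : BoolDef n φ p) : BoolDef n φ fun v => ¬ p v
  | and (p q : (ℕ → M) → Prop) (h : BoolDef n φ p) (h' : BoolDef n φ q) :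
      BoolDef n φ fun v => p v ∧ q v

section BoolDef

variable {L : FirstOrder.Language.{u, v}} {M : Type w} [L.Structure M] {n m k : ℕ}
  {φ : Fin m → L.Formula (Fin k)}

theorem BoolDef.const (P : Prop) : BoolDef (M := M) n φ fun _ => P := by
  by_cases hP : P
  · simpa [hP] using BoolDef.small (M := M) (φ := φ) (⊤ : L.Formula (Fin n)) fun _ => 0
  · simpa [hP] using BoolDef.small (M := M) (φ := φ) (⊥ : L.Formula (Fin n)) fun _ => 0

theorem BoolDef.or {p q : (ℕ → M) → Prop} (h : BoolDef n φ p) (h' : BoolDef n φ q) :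
    BoolDef n φ fun v => p v ∨ q v := by
  simpa only [not_and_or, not_not] using (BoolDef.and _ _ (h.not _) (h'.not _)).not

theorem BoolDef.forall_mem {β : Type*} (s : Finset β) {q : β → (ℕ → M) → Prop}
    (h : ∀ b ∈ s, BoolDef n φ (q b)) : BoolDef n φ fun v => ∀ b ∈ s, q b v := by
  classical
  induction s using Finset.induction_on with
  | empty => simpa using BoolDef.const True
  | insert b s _ ih =>
    simpa only [Finset.forall_mem_insert] using
      (h b (Finset.mem_insert_self _ _)).and _ _ (ih fun c hc => h c (Finset.mem_insert_of_mem hc))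

theorem BoolDef.of_boolComb {Δ : Set (L.Formula ℕ)} (hΔ : ∀ θ ∈ Δ, BoolDef (M := M) n φ θ.Realize)
    {ψ : L.Formula ℕ} (hψ : BoolComb Δ ψ) : BoolDef (M := M) n φ ψ.Realize := by
  induction hψ with
  | of ψ h => exact hΔ ψ h
  | not ψ _ ih => simpa only [← Formula.realize_not] using ih.not
  | and ψ χ _ _ ih ih' => simpa only [← Formula.realize_inf] using ih.and _ _ ih'
  | or ψ χ _ _ ih ih' => simpa only [← Formula.realize_sup] using ih.or ih'

/-- Completeness lets `T`-equivalence be tested in `M`, so syntactic Boolean combinations can be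
replaced by the predicates they define. -/
theorem almostNAry_iff {T : L.Theory} (hT : T.IsComplete) [Nonempty M] [M ⊨ T] :
    AlmostNAry n T ↔ ∃ (m k : ℕ) (φ : Fin m → L.Formula (Fin k)),
      ∀ χ : L.Formula ℕ, BoolDef (M := M) n φ χ.Realize := by
  refine exists_congr fun m => exists_congr fun k => exists_congr fun φ =>
    forall_congr' fun χ => ⟨?_, fun h => ?_⟩
  · rintro ⟨ψ, hψ, hχ⟩
    rw [funext fun v => propext ((iff_of_isComplete hT M).1 hχ v)]
    refine BoolDef.of_boolComb ?_ hψ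
    rintro θ (⟨ρ, hρ, hθ⟩ | hθ)
    · rw [funext fun v => propext ((iff_of_isComplete hT M).1 hθ v)]
      refine BoolDef.of_boolComb ?_ hρ
      intro η hη
      obtain ⟨ζ, f, rfl⟩ := Set.mem_iUnion.1 hη
      rw [show (ζ.relabel f).Realize = fun v : ℕ → M => ζ.Realize (v ∘ f) from
        funext fun v => propext Formula.realize_relabel]
      exact .small ζ f
    · obtain ⟨i, f, rfl⟩ := Set.mem_iUnion.1 hθ
      rw [show ((φ i).relabel f).Realize = fun v : ℕ → M => (φ i).Realize (v ∘ f) from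
        funext fun v => propext Formula.realize_relabel]
      exact .subst i f
  · simp only [iff_of_isComplete hT M]
    generalize hp : (χ.Realize : (ℕ → M) → Prop) = p at h
    clear hp
    induction h with
    | small ζ f =>
      have hζ : ζ.relabel f ∈ ⋃ χ : L.Formula (Fin n), substInstances χ :=
        Set.mem_iUnion.2 ⟨ζ, f, rfl⟩
      exact ⟨ζ.relabel f, .of _ (Or.inl ⟨_, .of _ hζ, Theory.Iff.refl _⟩),
        fun v => by rw [Formula.realize_relabel]⟩
    | subst i f =>
      exact ⟨(φ i).relabel f, .of _ (Or.inr (Set.mem_iUnion.2 ⟨i, f, rfl⟩)),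
        fun v => by rw [Formula.realize_relabel]⟩
    | not p _ ih =>
      obtain ⟨ψ, hψ, h⟩ := ih
      exact ⟨ψ.not, hψ.not, fun v => (not_congr (h v)).trans Formula.realize_not.symm⟩
    | and p q _ _ ih ih' =>
      obtain ⟨ψ, hψ, h⟩ := ih
      obtain ⟨ψ', hψ', h'⟩ := ih'
      exact ⟨ψ ⊓ ψ', hψ.and _ _ hψ', fun v => (and_congr (h v) (h' v)).trans Formula.realize_inf.symm⟩

end BoolDef

/-- If the structure on `M × N` is determined by the structures `M` and `N`, and defines the outer
and inner predicates, then almost `n`-arity passes from `M` and `N` to `M × N`. -/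
theorem almostNAry_prod {L : FirstOrder.Language.{u, v}} {L₁ : FirstOrder.Language.{u₁, v₁}}
    {L₂ : FirstOrder.Language.{u₂, v₂}} {M : Type w₁} {N : Type w₂} [L₁.Structure M]
    [L₂.Structure N] [L.IsRelational] [L.Structure (M × N)] [Nonempty M] [Nonempty N]
    (rel : ∀ (k : ℕ) (R : L.Relations k) (f : Fin k → ℕ),
      Determined L₁ L₂ (fun _ : Unit => M) (fun _ : Unit => N) fun _ v => Structure.RelMap R (v ∘ f))
    (outer : ∀ {k : ℕ} (θ : L₁.Formula (Fin k)), ∃ φ : L.Formula (Fin k),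
      ∀ x : Fin k → M × N, φ.Realize x ↔ θ.Realize fun i => (x i).1)
    (inner : ∀ {k : ℕ} (θ : L₂.Formula (Fin k)), ∃ φ : L.Formula (Fin k),
      ∀ x : Fin k → M × N,
        φ.Realize x ↔ (∀ i j, (x i).1 = (x j).1) ∧ θ.Realize fun i => (x i).2)
    {T₁ : L₁.Theory} (hT₁ : T₁.IsComplete) [M ⊨ T₁] {T₂ : L₂.Theory} (hT₂ : T₂.IsComplete)
    [N ⊨ T₂] {n : ℕ} (hn : 2 ≤ n) (h₁ : AlmostNAry n T₁) (h₂ : AlmostNAry n T₂) :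
    AlmostNAry n (L.completeTheory (M × N)) := by
  obtain ⟨m₁, k₁, φ₁, h₁⟩ := (almostNAry_iff (M := M) hT₁).1 h₁
  obtain ⟨m₂, k₂, φ₂, h₂⟩ := (almostNAry_iff (M := N) hT₂).1 h₂
  choose out hout using @outer
  choose inn hinn using @inner
  let φ : Fin (m₁ + m₂) → L.Formula (Fin (k₁ + k₂)) :=
    Fin.append (fun i => (out (φ₁ i)).relabel (Fin.castAdd k₂))
      fun i => (inn (φ₂ i)).relabel (Fin.natAdd k₁)
  refine (almostNAry_iff (M := M × N) (completeTheory.isComplete L (M × N))).2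
    ⟨m₁ + m₂, k₁ + k₂, φ, fun χ => ?_⟩
  have bout (p : (ℕ → M) → Prop) (hp : BoolDef n φ₁ p) :
      BoolDef n φ fun v : ℕ → M × N => p fun k => (v k).1 := by
    induction hp with
    | small χ f =>
      convert BoolDef.small (out χ) f using 2 with v
      rw [hout]
      rfl
    | subst i f =>
      -- The list `φ` has the common arity `k₁ + k₂`; the dummy block of variables is sent to `0`.
      convert BoolDef.subst (Fin.castAdd m₂ i) (Fin.append f fun _ => 0) using 2 with v
      simp only [φ, Fin.append_left, Formula.realize_relabel, hout]
      simp [Function.comp_def]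
    | not p _ ih => exact ih.not
    | and p q _ _ ih ih' => exact ih.and _ _ ih'
  have same (j k : ℕ) : BoolDef n φ fun v : ℕ → M × N => (v j).1 = (v k).1 := by
    obtain ⟨n, rfl⟩ := Nat.exists_eq_add_of_le' hn
    refine bout (fun u => u j = u k) ?_
    convert BoolDef.small (M := M) (φ := φ₁) (n := n + 2)
      (Term.equal (Term.var 0) (Term.var 1)) (Fin.cons j fun _ => k) using 2 with u
    rw [Formula.realize_equal]
    rfl
  refine Determined.bool_induction (L₁ := L₁) (L₂ := L₂) (s := fun _ v => χ.Realize v)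
    BoolDef.const BoolDef.not BoolDef.and (fun θ => bout _ (h₁ θ)) (fun D θ hθ => ?_)
    (determined_realize_nat rel χ)
  obtain rfl | ⟨d, hd⟩ := D.eq_empty_or_nonempty
  · obtain ⟨b⟩ := ‹Nonempty N›
    convert BoolDef.const (θ.Realize fun _ => b) using 2 with v
    simpa using ⟨hθ _ _ (by simp), hθ _ _ (by simp)⟩
  · classical
    -- Retraction of all variables onto `D`. The decomposition of `θ` may mention variables outside
    -- `D`; after `r` they all lie in one copy of `N`, and the value of `θ` is unchanged because it
    -- depends only on `D`.
    let r : ℕ → ℕ := fun k => if k ∈ D then k else d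
    have hr (k : ℕ) : r k ∈ D := by
      by_cases hk : k ∈ D <;> simp [r, hk, hd]
    have hrD {k : ℕ} (hk : k ∈ D) : r k = k := if_pos hk
    have hconst : BoolDef n φ fun v : ℕ → M × N => ∀ j ∈ D, ∀ k ∈ D, (v j).1 = (v k).1 :=
      BoolDef.forall_mem D fun j _ => BoolDef.forall_mem D fun k _ => same j k
    have binn (p : (ℕ → N) → Prop) (hp : BoolDef n φ₂ p) :
        BoolDef n φ fun v : ℕ → M × N => (∀ j ∈ D, ∀ k ∈ D, (v j).1 = (v k).1) ∧
          p fun k => (v (r k)).2 := by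
      induction hp with
      | small χ f =>
        convert hconst.and _ _ (BoolDef.small (inn χ) (r ∘ f)) using 2 with v
        refine and_congr_right fun h => ?_
        exact ((hinn χ _).trans (and_iff_right fun i j => h _ (hr _) _ (hr _))).symm
      | subst i f =>
        convert hconst.and _ _
          (BoolDef.subst (Fin.natAdd m₁ i) (Fin.append (fun _ => 0) (r ∘ f))) using 2 with v
        refine and_congr_right fun h => ?_
        simp only [φ, Fin.append_right, Formula.realize_relabel, hinn]
        rw [and_iff_right fun i j => by simpa using h _ (hr _) _ (hr _)]
        simp [Function.comp_def]
      | not p _ ih =>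
        convert hconst.and _ _ ih.not using 2 with v
        tauto
      | and p q _ _ ih ih' =>
        convert ih.and _ _ ih' using 2 with v
        tauto
    convert binn _ (h₂ θ) using 2 with v
    refine and_congr_right fun _ => ⟨hθ _ _ fun k hk => ?_, hθ _ _ fun k hk => ?_⟩ <;> rw [hrD hk]

end Product

/-! ### Definability of the outer and inner predicates -/

section Definability

universe u₁ v₁ w w₁ w₂

variable {L : FirstOrder.Language.{u, v}} {L' : FirstOrder.Language.{u₁, v₁}}

theorem UDef.exists_formula_fin {X : Type w} [L.Structure X] {k : ℕ} {P : (Fin k → X) → Prop}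
    (h : UDef L (fun _ : Unit => X) fun _ v => P fun i => v i) :
    ∃ φ : L.Formula (Fin k), ∀ x, φ.Realize x ↔ P x := by
  cases k with
  | zero =>
    by_cases hP : P default
    · exact ⟨⊤, fun x => by simpa [Subsingleton.elim x default] using hP⟩
    · exact ⟨⊥, fun x => by simpa [Subsingleton.elim x default] using hP⟩
  | succ k =>
    obtain ⟨φ, hφ⟩ := h
    refine ⟨φ.relabel (Fin.ofNat (k + 1)), fun x => ?_⟩
    rw [Formula.realize_relabel, hφ ()]
    simp

variable {M : Type w₁} {N : Type w₂} [L.Structure (M × N)]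

/-- `M` is interpreted as the quotient of `M × N` by equality of first coordinates; since `N` is
nonempty, quantifying over pairs quantifies over all of `M`. -/
theorem exists_outer_formula [L'.IsRelational] [L'.Structure M]
    (eq : ∀ j k, UDef L (fun _ : Unit => M × N) fun _ v => (v j).1 = (v k).1)
    (rel : ∀ (k : ℕ) (R : L'.Relations k) (f : Fin k → ℕ),
      UDef L (fun _ : Unit => M × N) fun _ v => Structure.RelMap R fun i => (v (f i)).1)
    [Nonempty N] {k : ℕ} (θ : L'.Formula (Fin k)) : ∃ φ : L.Formula (Fin k),
      ∀ x : Fin k → M × N, φ.Realize x ↔ θ.Realize fun i => (x i).1 := by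
  have := formula_induction (L := L') (X := fun _ : Unit => M)
    (P := fun p => UDef L (fun _ : Unit => M × N) fun _ v => p () fun k => (v k).1)
    (fun _ => UDef.not) (fun _ _ => UDef.and) (fun p j hp => ?_) eq rel θ Fin.val
  · refine UDef.exists_formula_fin ?_
    exact this
  · convert hp.ex j using 3 with i v
    have key (y : M × N) : (fun k => (Function.update v j y k).1) =
        Function.update (fun k => (v k).1) j y.1 := by
      ext k
      by_cases hk : k = j
      · subst hk; simp
      · simp [hk]
    simp only [key, Prod.exists, exists_const]

/-- Quantifiers are relativized to one class of `E`. The induction only asks that `p` be correct on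
assignments inside a single copy of `N`; constancy is imposed at the end. -/
theorem exists_inner_formula [L'.IsRelational] [L'.Structure N]
    (eq : ∀ j k, UDef L (fun _ : Unit => M × N) fun _ v => (v j).1 = (v k).1)
    (rel : ∀ (k : ℕ) (R : L'.Relations k) (f : Fin k → ℕ),
      UDef L (fun _ : Unit => M × N) fun _ v =>
        (∀ i j, (v (f i)).1 = (v (f j)).1) ∧ Structure.RelMap R fun i => (v (f i)).2)
    {k : ℕ} (θ : L'.Formula (Fin k)) : ∃ φ : L.Formula (Fin k),
      ∀ x : Fin k → M × N,
        φ.Realize x ↔ (∀ i j, (x i).1 = (x j).1) ∧ θ.Realize fun i => (x i).2 := by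
  have := formula_induction (L := L') (X := fun _ : Unit => N)
    (P := fun q => ∃ p, UDef L (fun _ : Unit => M × N) p ∧
      ∀ (a : M) (w : ℕ → N), p () (fun k => (a, w k)) ↔ q () w)
    (fun q ⟨p, hp, h⟩ => ⟨_, hp.not, fun a w => not_congr (h a w)⟩)
    (fun q q' ⟨p, hp, h⟩ ⟨p', hp', h'⟩ => ⟨_, hp.and hp', fun a w => and_congr (h a w) (h' a w)⟩)
    ?_ (fun j k => ⟨_, UDef.eq j k, fun a w => by simp⟩)
    (fun k R f => ⟨_, rel k R f, fun a w => by simp [Function.comp_def]⟩) θ Fin.val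
  · refine UDef.exists_formula_fin ?_
    cases k with
    | zero =>
      convert UDef.const (L := L) (X := fun _ : Unit => M × N) (θ.Realize default) using 3 with i v
      rw [and_iff_right fun i => i.elim0, Subsingleton.elim (fun i : Fin 0 => (v i).2) default]
    | succ k =>
      obtain ⟨p, hp, h⟩ := this
      have hE := UDef.forall_mem_finite (L := L) (X := fun _ : Unit => M × N)
        (Set.finite_univ (α := Fin (k + 1) × Fin (k + 1)))
        (q := fun ij _ v => (v ij.1).1 = (v ij.2).1) fun ij _ => eq _ _
      -- Reducing variables modulo `k + 1` puts the whole infinite assignment into one copy once the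
      -- first `k + 1` values are there.
      convert hE.and (hp.comp fun j => Fin.ofNat (k + 1) j) using 3 with i v
      simp only [Set.mem_univ, true_implies, Prod.forall]
      refine and_congr_right fun hv => ?_
      have hconst : (v ∘ fun j => (Fin.ofNat (k + 1) j : ℕ)) =
          fun j => ((v (0 : Fin (k + 1))).1, (v (Fin.ofNat (k + 1) j)).2) := by
        ext1 j
        exact Prod.ext (hv _ _) rfl
      have := h (v (0 : Fin (k + 1))).1 fun j => (v (Fin.ofNat (k + 1) j)).2
      rw [← hconst] at this
      rw [this]
      have hval : (fun j : Fin (k + 1) => (v (Fin.ofNat (k + 1) j)).2) =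
          fun j : Fin (k + 1) => (v j).2 := by
        ext1 j
        simp only [Fin.ofNat_val_eq_self]
      exact (iff_of_eq (congrArg (θ.Realize (M := N)) hval)).symm
  · rintro q j ⟨p, hp, h⟩
    -- Variable `j + 1` is untouched by the update at `j`, so it serves as a parameter naming the
    -- copy to which the quantifier is restricted.
    refine ⟨_, ((eq j (j + 1)).and hp).ex j, fun a w => ?_⟩
    have key (b : N) : Function.update (fun k => (a, w k)) j (a, b) =
        fun k => (a, Function.update w j b k) := by
      ext1 k
      by_cases hk : k = j
      · subst hk; simp
      · simp [hk]
    constructor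
    · rintro ⟨⟨a', b⟩, h₁, h₂⟩
      obtain rfl : a' = a := by simpa using h₁
      rw [key, h] at h₂
      exact ⟨b, h₂⟩
    · rintro ⟨b, hb⟩
      refine ⟨(a, b), by simp, ?_⟩
      rw [key, h]
      exact hb

end Definability

/-! ### Compositions -/

section Comp

variable {S : ℕ → Type u} {σ τ : Signature S}

instance (σ : Signature S) : σ.lang.IsRelational := fun _ => inferInstanceAs (IsEmpty PEmpty)

/-- An atomic relation is the disjunction of an outer predicate and an inner one on the range of
`f`. The languages `L₁`, `L₂` may be richer than the signatures, as needed for expansions. -/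
theorem determined_relMap_comp {L₁ : FirstOrder.Language.{u, u}} {L₂ : FirstOrder.Language.{u, u}}
    {I : Type v} {M N : I → Type u} [∀ i, σ.lang.Structure (M i)] [∀ i, τ.lang.Structure (N i)]
    [∀ i, L₁.Structure (M i)] [∀ i, L₂.Structure (N i)]
    (h₁ : ∀ (k : ℕ) (R : σ.lang.Relations k) (f : Fin k → ℕ),
      UDef L₁ M fun _ v => Structure.RelMap R (v ∘ f))
    (h₂ : ∀ (k : ℕ) (R : τ.lang.Relations k) (f : Fin k → ℕ),
      UDef L₂ N fun _ v => Structure.RelMap R (v ∘ f))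
    (k : ℕ) (R : (σ.union τ).lang.Relations k) (f : Fin k → ℕ) :
    Determined L₁ L₂ M N fun i v => (compStructure σ τ (M i) (N i)).RelMap R (v ∘ f) := by
  refine Determined.or ?_ ?_
  · by_cases h : R.1 ∈ σ k
    · simp only [h, exists_true_left]
      exact Determined.outer (h₁ k ⟨R.1, h⟩ f)
    · simpa only [h, IsEmpty.exists_iff] using Determined.const False
  · by_cases h : R.1 ∈ τ k
    · have := Determined.inner (L₁ := L₁) (M := M) (C := Finset.univ.image f) (h₂ k ⟨R.1, h⟩ f)
        fun i w w' hw => by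
          rw [show w ∘ f = w' ∘ f from funext fun j => hw _ (by simp)]
          exact id
      simp only [h, exists_true_left]
      convert this using 3 with i v
      simp only [Inner, Finset.mem_image, Finset.mem_univ, true_and, forall_exists_index,
        forall_apply_eq_imp_iff]
      rfl
    · simpa only [h, IsEmpty.exists_iff] using Determined.const False

theorem comp_elementarilyEquivalent (M N M' N' : Type u) [σ.lang.Structure M] [τ.lang.Structure N]
    [σ.lang.Structure M'] [τ.lang.Structure N'] [Nonempty M] [Nonempty N] [Nonempty M']
    [Nonempty N'] (hM : M ≅[σ.lang] M') (hN : N ≅[τ.lang] N') :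
    letI := compStructure σ τ M N
    letI := compStructure σ τ M' N'
    (M × N) ≅[(σ.union τ).lang] (M' × N') := by
  -- All pairs of structures form one family, of which the two given pairs are members.
  let X : CategoryTheory.Bundled.{u} σ.lang.Structure ×
      CategoryTheory.Bundled.{u} τ.lang.Structure → Type u := fun i => i.1
  let Y : CategoryTheory.Bundled.{u} σ.lang.Structure ×
      CategoryTheory.Bundled.{u} τ.lang.Structure → Type u := fun i => i.2
  let instX (i) : σ.lang.Structure (X i) := i.1.str
  let instY (i) : τ.lang.Structure (Y i) := i.2.str
  let instXY (i) : (σ.union τ).lang.Structure (X i × Y i) := compStructure σ τ (X i) (Y i)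
  let i : CategoryTheory.Bundled.{u} σ.lang.Structure ×
      CategoryTheory.Bundled.{u} τ.lang.Structure := (⟨M, inferInstance⟩, ⟨N, inferInstance⟩)
  let i' : CategoryTheory.Bundled.{u} σ.lang.Structure ×
      CategoryTheory.Bundled.{u} τ.lang.Structure := (⟨M', inferInstance⟩, ⟨N', inferInstance⟩)
  have : Nonempty (X i) := ‹Nonempty M›
  have : Nonempty (Y i) := ‹Nonempty N›
  have : Nonempty (X i') := ‹Nonempty M'›
  have : Nonempty (Y i') := ‹Nonempty N'›
  exact elementarilyEquivalent_prod (L := (σ.union τ).lang) (M := X) (N := Y)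
    (determined_relMap_comp (fun _ => UDef.rel) fun _ => UDef.rel) (i := i) (i' := i') hM hN

theorem DefinableInComp.uDef {M N : Type u} [σ.lang.Structure M] [τ.lang.Structure N] {α : Type}
    {s : Set (α → M × N)} (h : DefinableInComp σ τ M N s) (f : α → ℕ) :
    letI := compStructure σ τ M N
    UDef (σ.union τ).lang (fun _ : Unit => M × N) fun _ v => v ∘ f ∈ s := by
  let := compStructure σ τ M N
  obtain ⟨φ, rfl⟩ := Set.empty_definable_iff.1 h
  exact ⟨φ.relabel f, fun i v => Formula.realize_relabel⟩

theorem IsEDefComp.almostNAry {n : ℕ} (hn : 2 ≤ n) {T₁ T₂ T : RelTheory S}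
    (h : IsEDefComp T₁ T₂ T) (h₁ : AlmostNAry n T₁.theory) (h₂ : AlmostNAry n T₂.theory) :
    AlmostNAry n T.theory := by
  obtain ⟨M, N, _, _, _, _, _, _, rfl, hE, hsep⟩ := h
  let := compStructure T₁.sig T₂.sig M N
  have eq (j k : ℕ) : UDef (T₁.sig.union T₂.sig).lang (fun _ : Unit => M × N)
      fun _ v => (v j).1 = (v k).1 := hE.uDef ![j, k]
  refine almostNAry_prod (L := (T₁.sig.union T₂.sig).lang) (L₁ := T₁.sig.lang)
    (L₂ := T₂.sig.lang) (M := M) (N := N)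
    (determined_relMap_comp (fun _ => UDef.rel) fun _ => UDef.rel)
    (exists_outer_formula eq fun k R f => ?_) (exists_inner_formula eq fun k R f => ?_)
    T₁.complete T₂.complete hn h₁ h₂
  · by_cases hR : R.1 ∈ T₂.sig k
    · exact (hsep k R.1 R.2 hR).1.uDef f
    · convert UDef.rel (L := (T₁.sig.union T₂.sig).lang) (X := fun _ : Unit => M × N)
        ⟨R.1, Or.inl R.2⟩ f using 3 with i v
      exact (relMap_comp_of_left T₁.sig T₂.sig M N R.1 R.2 hR (v ∘ f)).symm
  · by_cases hR : R.1 ∈ T₁.sig k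
    · exact (hsep k R.1 hR R.2).2.uDef f
    · convert UDef.rel (L := (T₁.sig.union T₂.sig).lang) (X := fun _ : Unit => M × N)
        ⟨R.1, Or.inr R.2⟩ f using 3 with i v
      exact (relMap_comp_of_right T₁.sig T₂.sig M N R.1 hR R.2 (v ∘ f)).symm

/-- The relational language with a symbol for the outer predicate of each formula of `L₁` and a
symbol for the inner predicate of each formula of `L₂`. -/
def traceLang (L₁ L₂ : FirstOrder.Language.{u, u}) : FirstOrder.Language.{u, u} where
  Functions _ := PEmpty
  Relations k := L₁.Formula (Fin k) ⊕ L₂.Formula (Fin k)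

instance (L₁ L₂ : FirstOrder.Language.{u, u}) : (traceLang L₁ L₂).IsRelational :=
  fun _ => inferInstanceAs (IsEmpty PEmpty)

instance traceStructure (L₁ L₂ : FirstOrder.Language.{u, u}) (M N : Type u) [L₁.Structure M]
    [L₂.Structure N] : (traceLang L₁ L₂).Structure (M × N) where
  funMap f := PEmpty.elim f
  RelMap {k} R x := Sum.elim (fun θ : L₁.Formula (Fin k) => θ.Realize fun i => (x i).1)
    (fun θ : L₂.Formula (Fin k) =>
      (∀ i j, (x i).1 = (x j).1) ∧ θ.Realize fun i => (x i).2) R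

theorem IsComp.almostNAritizable {n : ℕ} (hn : 2 ≤ n) {T₁ T₂ T : RelTheory S}
    (h : IsComp T₁ T₂ T) (h₁ : AlmostNAritizable n T₁.theory)
    (h₂ : AlmostNAritizable n T₂.theory) : AlmostNAritizable n T.theory := by
  obtain ⟨M₀, N₀, _, _, _, _, _, _, rfl⟩ := h
  obtain ⟨K₁, T₁', hc₁, hs₁, ha₁⟩ := h₁
  obtain ⟨K₂, T₂', hc₂, hs₂, ha₂⟩ := h₂
  obtain ⟨M⟩ := hc₁.1
  obtain ⟨N⟩ := hc₂.1
  let : T₁.sig.lang.Structure M := (LHom.sumInl : _ →ᴸ T₁.sig.lang.sum K₁).reduct M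
  let : T₂.sig.lang.Structure N := (LHom.sumInl : _ →ᴸ T₂.sig.lang.sum K₂).reduct N
  have hM : M ⊨ T₁.theory :=
    ((LHom.sumInl : _ →ᴸ T₁.sig.lang.sum K₁).onTheory_model T₁.theory).1 (M.is_model.mono hs₁)
  have hN : N ⊨ T₂.theory :=
    ((LHom.sumInl : _ →ᴸ T₂.sig.lang.sum K₂).onTheory_model T₂.theory).1 (N.is_model.mono hs₂)
  have hMN := comp_elementarilyEquivalent (σ := T₁.sig) (τ := T₂.sig) M₀ N₀ M N
    (T₁.complete.models_elementarily_equivalent M₀ M)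
    (T₂.complete.models_elementarily_equivalent N₀ N)
  let := compStructure T₁.sig T₂.sig M N
  let K := traceLang (T₁.sig.lang.sum K₁) (T₂.sig.lang.sum K₂)
  -- Elementary equivalence is equality of complete theories, so `M₀[N₀]` may be replaced by the
  -- composition of the reducts of `M` and `N`.
  refine (congrArg (AlmostNAritizable (L := (T₁.sig.union T₂.sig).lang) n) hMN).mpr ?_
  refine ⟨K, ((T₁.sig.union T₂.sig).lang.sum K).completeTheory (M × N),
    completeTheory.isComplete _ _, ?_, ?_⟩
  · rw [← Theory.model_iff_subset_completeTheory]
    refine ((LHom.sumInl : _ →ᴸ (T₁.sig.union T₂.sig).lang.sum K).onTheory_model _).2 ?_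
    rw [Theory.model_iff_subset_completeTheory]
  · have rel (k : ℕ) (R : ((T₁.sig.union T₂.sig).lang.sum K).Relations k) (f : Fin k → ℕ) :
        Determined (T₁.sig.lang.sum K₁) (T₂.sig.lang.sum K₂) (fun _ : Unit => (M : Type u))
          (fun _ : Unit => (N : Type u)) fun _ v => Structure.RelMap R (v ∘ f) := by
      rcases R with R | θ | θ
      · exact determined_relMap_comp
          (fun k R f => UDef.rel (L := T₁.sig.lang.sum K₁) (X := fun _ : Unit => M) (Sum.inl R) f)
          (fun k R f => UDef.rel (L := T₂.sig.lang.sum K₂) (X := fun _ : Unit => N) (Sum.inl R) f)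
          k R f
      · exact Determined.outer ⟨θ.relabel f, fun i v => Formula.realize_relabel⟩
      · have := Determined.inner (L₁ := T₁.sig.lang.sum K₁) (L₂ := T₂.sig.lang.sum K₂)
          (M := fun _ : Unit => M) (N := fun _ : Unit => N) (C := Finset.univ.image f)
          (q := fun _ v => θ.Realize (v ∘ f)) ⟨θ.relabel f, fun i v => Formula.realize_relabel⟩
          fun i w w' hw => by
            simp only [show w ∘ f = w' ∘ f from funext fun j => hw _ (by simp)]
            exact id
        convert this using 3 with i v
        simp only [Inner, Finset.mem_image, Finset.mem_univ, true_and, forall_exists_index,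
          forall_apply_eq_imp_iff]
        rfl
    refine almostNAry_prod (L := (T₁.sig.union T₂.sig).lang.sum K)
      (L₁ := T₁.sig.lang.sum K₁) (L₂ := T₂.sig.lang.sum K₂) (M := M) (N := N)
      rel (fun {k} θ => ?_) (fun {k} θ => ?_) hc₁ hc₂ hn ha₁ ha₂
    · exact ⟨Relations.formula (L := (T₁.sig.union T₂.sig).lang.sum K) (Sum.inr (Sum.inl θ)) Term.var,
        fun x => Formula.realize_rel⟩
    · exact ⟨Relations.formula (L := (T₁.sig.union T₂.sig).lang.sum K) (Sum.inr (Sum.inr θ)) Term.var,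
        fun x => Formula.realize_rel⟩

theorem FiniteComp.induction {comp : RelTheory S → RelTheory S → RelTheory S → Prop}
    {P : RelTheory S → Prop} (hcomp : ∀ T₁ T₂ T, comp T₁ T₂ T → P T₁ → P T₂ → P T)
    {l : List (RelTheory S)} {T : RelTheory S} (h : FiniteComp comp l T) :
    (∀ T' ∈ l, P T') → P T := by
  induction h with
  | single T => exact fun h => h T (List.mem_singleton_self T)
  | comp l₁ l₂ T₁ T₂ T _ _ h ih₁ ih₂ =>
    exact fun hl => hcomp T₁ T₂ T h (ih₁ fun T' h' => hl T' (List.mem_append_left _ h'))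
      (ih₂ fun T' h' => hl T' (List.mem_append_right _ h'))

end Comp

end AlmostArity

theorem mainTheorem12 {S : ℕ → Type u} (n : ℕ) (hn : 2 ≤ n)
    (l : List (AlmostArity.RelTheory S)) (T : AlmostArity.RelTheory S) :
    ((∀ T' ∈ l, AlmostArity.AlmostNAry n T'.theory) →
      AlmostArity.FiniteComp AlmostArity.IsEDefComp l T →
        AlmostArity.AlmostNAry n T.theory) ∧
    ((∀ T' ∈ l, AlmostArity.AlmostNAritizable n T'.theory) →
      AlmostArity.FiniteComp AlmostArity.IsComp l T →
        AlmostArity.AlmostNAritizable n T.theory) :=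
  ⟨fun hl h => h.induction (P := fun T => AlmostArity.AlmostNAry n T.theory)
      (fun _ _ _ h h₁ h₂ => h.almostNAry hn h₁ h₂) hl,
    fun hl h => h.induction (P := fun T => AlmostArity.AlmostNAritizable n T.theory)
      (fun _ _ _ h h₁ h₂ => h.almostNAritizable hn h₁ h₂) hl⟩
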